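/- Let \(d\ge 1\), let \(S_d\) be a non-empty finite discrete space and let \(S=\mathbb R^d\times S_d\). Let \(b\colon S\to\mathbb R^d\) and \(a\colon S\to\mathbb S^d\) be Borel and locally bounded, where \(\mathbb S^d\) is the set of real symmetric non-negative definite \(d\times d\) matrices, and for each \(x\in\mathbb R^d\) let \(Q(x)=(q_{ij}(x))_{i,j\in S_d}\) be a conservative \(Q\)-matrix (i.e. \(q_{ij}(x)\ge 0\) for \(i\ne j\) and \(\sum_{j}q_{ij}(x)=0\)) such that \(x\mapsto Q(x)\) is Borel. Let \(\Omega\) be the space of càdlàg functions \(\mathbb R_+\to S\) with coordinate process \(X\), \(\mathcal F=\sigma(X_t, t\ge 0)\) and \(\mathcal F_t=\bigcap_{s>t}\sigma(X_u,u\le s)\). Let \(\Sigma\subset\Omega\) be the set of paths whose \(\mathbb R^d\)-component is continuous, let \(D=\{f,\,fg,\,g\colon f\in C_b^2(\mathbb R^d),\ g\colon S_d\to\mathbb R\}\), where \(C_b^2(\mathbb R^d)\) is the set of \(C^2\) functions that are bounded together with their derivatives of order one and two, and put \[\mathcal L f(x,i)=\langle\nabla_x f(x,i),b(x,i)\rangle+\tfrac12\,\mathrm{trace}\,(\nabla_x^2f(x,i)\,a(x,i))+\sum_{j\in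 S_d}q_{ij}(x)f(x,j).\] Assume that \(\int_0^t|\mathcal Lf(\omega(s))|\,ds<\infty\) for all \(f\in D\), \(\omega\in\Omega\), \(t\ge 0\). For each \(y\in S\) let \(P_y\) be a solution of the martingale problem \((D,\mathcal L,\Sigma,y)\), i.e. a probability measure on \((\Omega,\mathcal F)\) with \(P_y(\Sigma)=1\), \(P_y(X_0=y)=1\), such that \(f(X_t)-f(X_0)-\int_0^t\mathcal Lf(X_s)\,ds\), \(t\ge0\), is a local \(P_y\)-martingale with respect to \((\mathcal F_t)\) for all \(f\in D\). Assume that there are an \(r>0\) and locally Hölder continuous functions \(b_d\colon[r,\infty)\to\mathbb R\) and \(a_d\colon[r,\infty)\to(0,\infty)\) such that for all \(i\in S_d\) and all \(x\in\mathbb R^d\) with \(\|x\|\ge 2r\) and \(\|x\|^2/2\ge r\) \[\langle x,a(x,i)x\rangle\ge a_d\big(\tfrac{\|x\|^2}{2}\big),\qquad \mathrm{trace}\,a(x,i)+2\langle x,b(x,i)\rangle\le b_d\big(\tfrac{\|x\|^2}{2}\big)\langle x,a(x,i)x\rangle,\] and that \[p(t)=\int_{r+1}^t\exp\Big(-\int_{r+1}^y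 b_d(z)\,dz\Big)dy\to\infty\ \text{ as } t\to\infty,\qquad \int_{r+1}^\infty p'(y)\int_y^\infty\frac{dz}{a_d(z)p'(z)}\,dy<\infty.\] Then the family \((P_y)_{y\in S}\) is not Feller-Dynkin. Here, \((P_y)_{y\in S}\) is called Feller-Dynkin if \(y\mapsto P_y(G)\) is Borel for all \(G\in\mathcal F\); \(P_y(\theta_t^{-1}G\mid\mathcal F_t)=P_{X_t}(G)\) \(P_y\)-a.s. for all \(y\in S\), \(t\ge 0\), \(G\in\mathcal F\), where \(\theta_t\omega(s)=\omega(t+s)\); and, with \(T_tf(y)=E_y[f(X_t)]\), one has \(T_t(C_b(S))\subseteq C_b(S)\) and \(T_t(C_0(S))\subseteq C_0(S)\) for all \(t\ge0\). -/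

import Mathlib

open MeasureTheory Filter Topology Set
open scoped NNReal ENNReal Matrix

noncomputable section

/-! ### Càdlàg paths, coordinate filtrations, martingale problems -/

section Paths

variable {S : Type*} [TopologicalSpace S]

/-- Right-continuous with left limits. -/
def IsCadlag (ω : ℝ≥0 → S) : Prop :=
  (∀ t, ContinuousWithinAt ω (Ici t) t) ∧ ∀ t, 0 < t → ∃ l, Tendsto ω (𝓝[<] t) (𝓝 l)

variable (S) in
/-- The path space `Ω` of all càdlàg functions `ℝ₊ → S`. With its instance as a subtype of
`ℝ≥0 → S`, its σ-field is the one generated by all the coordinates. -/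
abbrev CadlagPath : Type _ := {ω : ℝ≥0 → S // IsCadlag ω}

/-- The coordinate process `X`. -/
def coord (t : ℝ≥0) (ω : CadlagPath S) : S := ω.1 t

lemma isCadlag_shift {ω : ℝ≥0 → S} (h : IsCadlag ω) (t : ℝ≥0) :
    IsCadlag fun s => ω (t + s) := by
  refine ⟨fun s => ?_, fun s hs => ?_⟩
  · refine (h.1 (t + s)).comp (f := fun s : ℝ≥0 => t + s)
      (by fun_prop) (fun u hu => ?_)
    exact add_le_add_right (mem_Ici.1 hu) t
  · obtain ⟨l, hl⟩ := h.2 (t + s) (lt_of_lt_of_le hs le_add_self)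
    refine ⟨l, hl.comp (tendsto_nhdsWithin_iff.2 ⟨?_, ?_⟩)⟩
    · have : Continuous fun s : ℝ≥0 => t + s := by fun_prop
      exact (this.tendsto s).mono_left nhdsWithin_le_nhds
    · filter_upwards [self_mem_nhdsWithin] with u hu
      exact add_lt_add_right (mem_Iio.1 hu) t

/-- The shift `θ_t`, i.e. `(θ_t ω)(s) = ω(t + s)`. -/
def shift (t : ℝ≥0) (ω : CadlagPath S) : CadlagPath S :=
  ⟨fun s => ω.1 (t + s), isCadlag_shift ω.2 t⟩

variable [MeasurableSpace S]

lemma measurable_coord (t : ℝ≥0) : Measurable (coord t : CadlagPath S → S) :=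
  (measurable_pi_apply t).comp measurable_subtype_coe

variable (S) in
/-- The filtration `ℱᵒ_t = σ(X_s, s ≤ t)`. -/
def rawFiltration : Filtration ℝ≥0 (inferInstance : MeasurableSpace (CadlagPath S)) where
  seq t := ⨆ s ≤ t, MeasurableSpace.comap (coord s) inferInstance
  mono' _ _ hij := biSup_mono fun _ h => h.trans hij
  le' _ := iSup₂_le fun s _ => (measurable_coord s).comap_le

variable (S) in
/-- The filtration `ℱ_t = ⋂_{s > t} ℱᵒ_s`. -/
def pathFiltration : Filtration ℝ≥0 (inferInstance : MeasurableSpace (CadlagPath S)) :=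
  (rawFiltration S).rightCont

/-- `M` is a local `P`-martingale for the filtration `ℱ`. -/
def IsLocalMartingale {Ω : Type*} {m : MeasurableSpace Ω} (M : ℝ≥0 → Ω → ℝ)
    (ℱ : Filtration ℝ≥0 m) (P : Measure Ω) : Prop :=
  ProbabilityTheory.Locally (fun Y => Martingale Y ℱ P) ℱ M P

/-- The process `f(X_t) - f(X_0) - ∫₀ᵗ 𝓛f(X_s) ds`, where `g` stands for `𝓛f`. -/
def mpProcess (f g : S → ℝ) (t : ℝ≥0) (ω : CadlagPath S) : ℝ :=
  f (ω.1 t) - f (ω.1 0) - ∫ s in (0 : ℝ)..t, g (ω.1 s.toNNReal)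

/-- `∫₀ᵗ |𝓛f(ω(s))| ds < ∞` for all `f ∈ D`, all càdlàg paths `ω` and all times `t`. -/
def IntegrableAlongPaths (D : Set (S → ℝ)) (L : (S → ℝ) → S → ℝ) : Prop :=
  ∀ f ∈ D, ∀ (ω : CadlagPath S) (t : ℝ≥0),
    IntervalIntegrable (fun s : ℝ => L f (ω.1 s.toNNReal)) volume 0 t

/-- `P` solves the martingale problem `(D, 𝓛, Σ, η)`. -/
structure IsMPSolution (D : Set (S → ℝ)) (L : (S → ℝ) → S → ℝ) (Sig : Set (CadlagPath S))
    (η : Measure S) (P : Measure (CadlagPath S)) : Prop where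
  isProbabilityMeasure : IsProbabilityMeasure P
  paths : ∀ᵐ ω ∂P, ω ∈ Sig
  initial : P.map (coord 0) = η
  localMartingale : ∀ f ∈ D, IsLocalMartingale (mpProcess f (L f)) (pathFiltration S) P

/-! ### Markov, `C_b`-Feller and Feller-Dynkin families -/

/-- The family `(P_x)` is Markov: it depends on `x` in a Borel way, and
`P_x(θ_t⁻¹ G | ℱ_t) = P_{X_t}(G)` holds `P_x`-almost surely. -/
structure IsMarkovFamily (P : S → Measure (CadlagPath S)) : Prop where
  measurable : ∀ G, MeasurableSet G → Measurable fun x => P x G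
  markov : ∀ (x : S) (t : ℝ≥0) (G : Set (CadlagPath S)), MeasurableSet G →
    (P x)[(shift t ⁻¹' G).indicator (fun _ => (1 : ℝ)) | pathFiltration S t]
      =ᵐ[P x] fun ω => (P (coord t ω)).real G

/-- `T_t f(x) = E_x[f(X_t)]`. -/
def transition (P : S → Measure (CadlagPath S)) (t : ℝ≥0) (f : S → ℝ) (x : S) : ℝ :=
  ∫ ω, f (coord t ω) ∂(P x)

/-- Markov, and `T_t` maps `C_b(S)` into `C_b(S)`. -/
structure IsCbFellerFamily (P : S → Measure (CadlagPath S)) : Prop where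
  isMarkovFamily : IsMarkovFamily P
  map_Cb : ∀ (t : ℝ≥0) (f : BoundedContinuousFunction S ℝ),
    ∃ g : BoundedContinuousFunction S ℝ, ⇑g = transition P t f

/-- `C_b`-Feller, and `T_t` maps `C_0(S)` into `C_0(S)`. -/
structure IsFellerDynkinFamily (P : S → Measure (CadlagPath S)) : Prop where
  isCbFellerFamily : IsCbFellerFamily P
  map_C0 : ∀ (t : ℝ≥0) (f : ZeroAtInftyContinuousMap S ℝ),
    ∃ g : ZeroAtInftyContinuousMap S ℝ, ⇑g = transition P t f

end Paths

/-! ### Switching diffusions on `ℝᵈ × S_d` -/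

section Switching

variable {d : ℕ} {Sd : Type*}

/-- `C_b²(ℝᵈ)`: twice continuously differentiable, bounded together with the derivatives of order
one and two. -/
def IsCb2 (f : EuclideanSpace ℝ (Fin d) → ℝ) : Prop :=
  ContDiff ℝ 2 f ∧ ∃ C : ℝ, ∀ k ≤ 2, ∀ x, ‖iteratedFDeriv ℝ k f x‖ ≤ C

/-- The test functions `f(x)`, `f(x) g(i)` and `g(i)` with `f ∈ C_b²(ℝᵈ)`, `g : S_d → ℝ`. -/
def switchingTestFunctions (d : ℕ) (Sd : Type*) : Set (EuclideanSpace ℝ (Fin d) × Sd → ℝ) :=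
  {h | (∃ f, IsCb2 f ∧ h = fun y => f y.1) ∨
    (∃ f, IsCb2 f ∧ ∃ g : Sd → ℝ, h = fun y => f y.1 * g y.2) ∨
    ∃ g : Sd → ℝ, h = fun y => g y.2}

/-- The Hessian matrix of `f` at `x`. -/
def hessianMatrix (f : EuclideanSpace ℝ (Fin d) → ℝ) (x : EuclideanSpace ℝ (Fin d)) :
    Matrix (Fin d) (Fin d) ℝ :=
  Matrix.of fun k l =>
    iteratedFDeriv ℝ 2 f x ![EuclideanSpace.single k 1, EuclideanSpace.single l 1]

/-- `𝓚f(x, i) = ⟨∇ₓf(x, i), b(x, i)⟩ + ½ trace (∇ₓ²f(x, i) a(x, i))`. -/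
def diffusionOperator (b : EuclideanSpace ℝ (Fin d) × Sd → EuclideanSpace ℝ (Fin d))
    (a : EuclideanSpace ℝ (Fin d) × Sd → Matrix (Fin d) (Fin d) ℝ)
    (f : EuclideanSpace ℝ (Fin d) × Sd → ℝ) (y : EuclideanSpace ℝ (Fin d) × Sd) : ℝ :=
  inner ℝ (gradient (fun x => f (x, y.2)) y.1) (b y)
    + 1 / 2 * (hessianMatrix (fun x => f (x, y.2)) y.1 * a y).trace

/-- `𝓛f(x, i) = 𝓚f(x, i) + ∑ⱼ q_{ij}(x) f(x, j)`. -/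
def switchingOperator [Fintype Sd]
    (b : EuclideanSpace ℝ (Fin d) × Sd → EuclideanSpace ℝ (Fin d))
    (a : EuclideanSpace ℝ (Fin d) × Sd → Matrix (Fin d) (Fin d) ℝ)
    (Q : EuclideanSpace ℝ (Fin d) → Matrix Sd Sd ℝ)
    (f : EuclideanSpace ℝ (Fin d) × Sd → ℝ) (y : EuclideanSpace ℝ (Fin d) × Sd) : ℝ :=
  diffusionOperator b a f y + ∑ j, Q y.1 y.2 j * f (y.1, j)

/-- The paths whose `ℝᵈ`-component is continuous. -/
def switchingPaths (d : ℕ) (Sd : Type*) [TopologicalSpace Sd] :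
    Set (CadlagPath (EuclideanSpace ℝ (Fin d) × Sd)) :=
  {ω | Continuous fun t => (ω.1 t).1}

/-- Conservative `Q`-matrix on a finite set: nonnegative off the diagonal, with row sums zero,
i.e. `-q_{ii} = ∑_{j ≠ i} q_{ij}`. -/
structure IsConservativeQMatrix [Fintype Sd] (q : Matrix Sd Sd ℝ) : Prop where
  nonneg : ∀ i j, i ≠ j → 0 ≤ q i j
  row_sum : ∀ i, ∑ j, q i j = 0

/-- Coefficients of a switching diffusion: `b` and `a` are Borel and locally bounded, `a` takes
values in the symmetric non-negative definite matrices, and `x ↦ Q(x)` is a Borel map into the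
conservative `Q`-matrices. -/
structure IsSwitchingCoefficients [Fintype Sd] [TopologicalSpace Sd] [MeasurableSpace Sd]
    (b : EuclideanSpace ℝ (Fin d) × Sd → EuclideanSpace ℝ (Fin d))
    (a : EuclideanSpace ℝ (Fin d) × Sd → Matrix (Fin d) (Fin d) ℝ)
    (Q : EuclideanSpace ℝ (Fin d) → Matrix Sd Sd ℝ) : Prop where
  measurable_b : Measurable b
  locallyBounded_b : ∀ K, IsCompact K → ∃ C : ℝ, ∀ y ∈ K, ‖b y‖ ≤ C
  measurable_a : ∀ k l, Measurable fun y => a y k l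
  locallyBounded_a : ∀ K, IsCompact K → ∃ C : ℝ, ∀ y ∈ K, ∀ k l, |a y k l| ≤ C
  posSemidef_a : ∀ y, (a y).PosSemidef
  measurable_Q : ∀ i j, Measurable fun x => Q x i j
  conservative_Q : ∀ x, IsConservativeQMatrix (Q x)

end Switching

/-! ### Scale functions -/

/-- `f` is locally Hölder continuous on `s`: near every point of `s` it is Hölder continuous with
some exponent in `(0, 1]`. -/
def LocallyHolderOn (f : ℝ → ℝ) (s : Set ℝ) : Prop :=
  ∀ z ∈ s, ∃ u ∈ 𝓝[s] z, ∃ C α : ℝ≥0, 0 < α ∧ α ≤ 1 ∧ HolderOnWith C α f u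

/-- The derivative `p'(y) = exp (-∫_c^y β(z) dz)` of the scale function with base point `c`. -/
def scaleDensity (β : ℝ → ℝ) (c y : ℝ) : ℝ :=
  Real.exp (-∫ z in c..y, β z)

/-- The scale function `p(t) = ∫_c^t exp (-∫_c^y β(z) dz) dy` with base point `c`. -/
def scaleFunction (β : ℝ → ℝ) (c t : ℝ) : ℝ :=
  ∫ y in c..t, scaleDensity β c y

end

/-! The integral condition makes infinity an entrance boundary of a one-dimensional diffusion that
controls `V = ‖x‖² / 2`: paths come back from infinity in bounded expected time, whatever the
starting point. A semigroup preserving `C_0` forbids this, since over a bounded time a path started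
far away should stay far away.

Analytically, the equation `ψ'' + b_d ψ' = -2 / a_d` has, with scale density `p'`, the increasing
solution with `ψ'(y) = p'(y) ∫_y^∞ 2 / (a_d p')`, and the integral condition bounds `ψ`. Since `ψ' ≥
0`, the two coefficient bounds give `𝓛(ψ ∘ V) ≤ -1` far out; the switching part contributes nothing
to a function of `x` alone. Neither smoothness near the origin nor membership in `D` is automatic,
so `ψ'` is cut off smoothly below `R` and the source term beyond `N`. The result
(`exists_radial_lyapunov`) is compactly supported after composition with `V`, has bounds independent
of `N`, and satisfies `𝓛v ≤ g - h_N` with one fixed `g ∈ C_0` and `h_N → 1`.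

Taking expectations (`IsMPSolution.integral_transition_le`) and letting `N → ∞` yields `T ≤ U + ∫₀ᵀ
T_s g(z) ds` for every `z`. If each `T_s g` vanished at infinity, `z → ∞` would give `T ≤ U`, which
is false for `T = U + 1` (`not_isFellerDynkinFamily_of_lyapunov`). -/

/-- A local martingale that starts at zero and is bounded below has non-positive expectation:
every integrable lower bound of it has non-positive mean. -/
lemma IsLocalMartingale.integral_nonpos_of_le {Ω : Type*} {m : MeasurableSpace Ω}
    {M : ℝ≥0 → Ω → ℝ} {ℱ : Filtration ℝ≥0 m} {P : Measure Ω} [IsProbabilityMeasure P]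
    (hM : IsLocalMartingale M ℱ P) (h0 : ∀ ω, M 0 ω = 0) {T : ℝ≥0} {c : ℝ}
    (hc : ∀ t ≤ T, ∀ ω, -c ≤ M t ω) {L : Ω → ℝ} (hLint : Integrable L P)
    (hL : ∀ ω, L ω ≤ M T ω) : ∫ ω, L ω ∂P ≤ 0 := by
  obtain ⟨τ, hτ, hmart⟩ := hM
  obtain ⟨ω₀⟩ : Nonempty Ω := P.nonempty_of_neZero
  have c0 : 0 ≤ c := by have := hc 0 zero_le ω₀; rw [h0] at this; linarith
  -- Localization sets the process to zero where `τ n = ⊥`; the lower bound survives there because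
  -- `0 ≤ c`.
  set Y : ℕ → ℝ≥0 → Ω → ℝ := fun n =>
    stoppedProcess (fun i ↦ {ω | ⊥ < τ n ω}.indicator (M i)) (τ n) with hY
  have hYlow : ∀ n ω, -c ≤ Y n T ω := by
    intro n ω
    simp only [hY, stoppedProcess, Set.indicator]
    split_ifs
    · refine hc _ ?_ ω
      exact (WithTop.untopA_le (min_le_left _ _))
    · linarith
  have hYmean : ∀ n, ∫ ω, Y n T ω ∂P = 0 := by
    intro n
    have h1 := (hmart n).setIntegral_eq (zero_le (a := T)) MeasurableSet.univ
    simp only [Measure.restrict_univ] at h1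
    have h2 : ∀ ω, Y n 0 ω = 0 := by
      intro ω
      have : min ((0 : ℝ≥0) : WithTop ℝ≥0) (τ n ω) = ((0 : ℝ≥0) : WithTop ℝ≥0) :=
        min_eq_left (by exact bot_le)
      simp only [hY, stoppedProcess, this]
      change {ω | ⊥ < τ n ω}.indicator (M 0) ω = 0
      simp [Set.indicator, h0]
    exact h1.symm.trans ((integral_congr_ae (ae_of_all P h2)).trans (integral_zero _ _))
  have hYlim : ∀ᵐ ω ∂P, Tendsto (fun n => ENNReal.ofReal (Y n T ω + c)) atTop
      (𝓝 (ENNReal.ofReal (M T ω + c))) := by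
    filter_upwards [hτ.tendsto_top] with ω hω
    refine tendsto_const_nhds.congr' ?_
    have h1 : ∀ᶠ n in atTop, (T : WithTop ℝ≥0) < τ n ω :=
      hω.eventually (lt_mem_nhds (WithTop.coe_lt_top T))
    filter_upwards [h1] with n hn
    have h3 : ω ∈ {ω | ⊥ < τ n ω} := lt_of_le_of_lt bot_le hn
    simp only [hY, stoppedProcess, min_eq_left hn.le, Set.indicator_of_mem h3]
    rfl
  have hYint : ∀ n, ∫⁻ ω, ENNReal.ofReal (Y n T ω + c) ∂P = ENNReal.ofReal c := by
    intro n
    have hi : Integrable (Y n T) P := (hmart n).integrable T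
    rw [← ofReal_integral_eq_lintegral_ofReal (f := fun ω => Y n T ω + c)
      (hi.add (integrable_const c))
      (ae_of_all _ fun ω => by have := hYlow n ω; simp only [Pi.zero_apply]; linarith),
      integral_add hi (integrable_const c), hYmean]
    simp
  -- Fatou's lemma for the nonnegative variables `Y n T + c`, which all have mean `c`.
  have hF : ∫⁻ ω, ENNReal.ofReal (M T ω + c) ∂P ≤ ENNReal.ofReal c := by
    calc ∫⁻ ω, ENNReal.ofReal (M T ω + c) ∂P
        = ∫⁻ ω, liminf (fun n => ENNReal.ofReal (Y n T ω + c)) atTop ∂P :=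
          lintegral_congr_ae (hYlim.mono fun ω h => h.liminf_eq.symm)
      _ ≤ liminf (fun n => ∫⁻ ω, ENNReal.ofReal (Y n T ω + c) ∂P) atTop :=
          lintegral_liminf_le' fun n =>
            (((hmart n).integrable T).aemeasurable.add_const c).ennreal_ofReal
      _ = ENNReal.ofReal c := by simp [hYint]
  have h5 : ∫ ω, (L ω + c) ∂P ≤ c := by
    rw [integral_eq_lintegral_pos_part_sub_lintegral_neg_part
      (f := fun ω => L ω + c) (hLint.add (integrable_const c))]
    have h6 : (∫⁻ ω, ENNReal.ofReal (L ω + c) ∂P).toReal ≤ c := by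
      refine ENNReal.toReal_le_of_le_ofReal c0 (le_trans (lintegral_mono fun ω => ?_) hF)
      exact ENNReal.ofReal_le_ofReal (by linarith [hL ω])
    have h7 : 0 ≤ (∫⁻ ω, ENNReal.ofReal (-(L ω + c)) ∂P).toReal := ENNReal.toReal_nonneg
    linarith
  rw [integral_add hLint (integrable_const c)] at h5
  simpa using h5

/-! ### Occupation times and the abstract Lyapunov criterion -/

section CadlagPaths

variable {S : Type*} [TopologicalSpace S] [MeasurableSpace S]

lemma abs_transition_le {g : S → ℝ} {K : ℝ} (hK : ∀ x, |g x| ≤ K) (P : S → Measure (CadlagPath S)) (y : S)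
    [IsProbabilityMeasure (P y)] (t : ℝ≥0) : |transition P t g y| ≤ K := by
  simpa [transition] using norm_integral_le_of_norm_le_const (μ := P y) (f := fun ω => g (coord t ω)) (C := K)
    (ae_of_all _ fun ω => hK _)

variable [OpensMeasurableSpace S]

/-- The evaluation map `(s, ω) ↦ g (ω s)` is jointly measurable. -/
lemma measurable_comp_eval {g : S → ℝ} (hg : Continuous g) :
    Measurable fun p : ℝ × CadlagPath S => g (p.2.1 p.1.toNNReal) := by
  have key : Measurable fun p : ℝ≥0 × CadlagPath S => g (p.2.1 p.1) := by
    -- Rounding `s` up to a grid point strictly to its right: only countably many values occur,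
    -- which gives measurability, and right-continuity of paths gives convergence.
    set t : ℕ → ℝ≥0 → ℝ≥0 := fun n s => ((⌊s * (n + 1)⌋₊ : ℝ≥0) + 1) / (n + 1) with ht
    have tgt : ∀ n s, s < t n s := by
      intro n s
      rw [ht, lt_div_iff₀ (by positivity)]
      exact Nat.lt_floor_add_one _
    have tle : ∀ n s, t n s ≤ s + 1 / (n + 1) := by
      intro n s
      have h := Nat.floor_le (zero_le (a := s * ((n : ℝ≥0) + 1)))
      rw [ht]
      simp only
      rw [add_div]
      gcongr
      rw [div_le_iff₀ (by positivity)]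
      exact h
    have tlim : ∀ s, Tendsto (fun n => t n s) atTop (𝓝 s) := by
      intro s
      refine tendsto_of_tendsto_of_tendsto_of_le_of_le tendsto_const_nhds ?_
        (fun n => (tgt n s).le) (fun n => tle n s)
      simpa using (tendsto_const_nhds (x := s)).add
        (tendsto_one_div_add_atTop_nhds_zero_nat (𝕜 := ℝ≥0))
    refine measurable_of_tendsto_metrizable (f := fun n p => g (p.2.1 (t n p.1)))
      (fun n => ?_) ?_
    · have h1 : Measurable fun q : ℕ × CadlagPath S =>
          g (q.2.1 (((q.1 : ℝ≥0) + 1) / (n + 1))) :=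
        measurable_from_prod_countable_right fun k =>
          by
          exact hg.measurable.comp (measurable_coord (((k : ℝ≥0) + 1) / (n + 1)))
      have h2 : Measurable fun p : ℝ≥0 × CadlagPath S => (⌊p.1 * ((n : ℝ≥0) + 1)⌋₊, p.2) :=
        (Nat.measurable_floor.comp (measurable_fst.mul_const _)).prodMk measurable_snd
      exact h1.comp h2
    · rw [tendsto_pi_nhds]
      rintro ⟨s, ω⟩
      refine (hg.tendsto _).comp ((ω.2.1 s).tendsto.comp ?_)
      exact tendsto_nhdsWithin_iff.2 ⟨tlim s, Eventually.of_forall fun n => (tgt n s).le⟩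
  exact key.comp ((measurable_real_toNNReal.comp measurable_fst).prodMk measurable_snd)

variable {g : S → ℝ} {K : ℝ}

lemma intervalIntegrable_comp_path (hg : Continuous g) (hK : ∀ x, |g x| ≤ K) (ω : CadlagPath S)
    (u v : ℝ) : IntervalIntegrable (fun s : ℝ => g (ω.1 s.toNNReal)) volume u v := by
  refine (intervalIntegrable_const (c := K)).mono_fun ?_ ?_
  · exact ((measurable_comp_eval hg).comp (measurable_id.prodMk measurable_const)).aestronglyMeasurable
  · exact ae_of_all _ fun s => by
      simpa only [Real.norm_eq_abs] using (hK _).trans (le_abs_self K)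

lemma integrable_comp_eval_prod (hg : Continuous g) (hK : ∀ x, |g x| ≤ K)
    (P : Measure (CadlagPath S)) [IsProbabilityMeasure P] (T : ℝ) :
    Integrable (fun p : ℝ × CadlagPath S => g (p.2.1 p.1.toNNReal))
      ((volume.restrict (Ioc 0 T)).prod P) :=
  (integrable_const K).mono' (measurable_comp_eval hg).aestronglyMeasurable
    (ae_of_all _ fun _ => hK _)

/-- Fubini's theorem for the occupation integral `∫₀ᵀ g(X_s) ds`. -/
lemma integral_occupation (hg : Continuous g) (hK : ∀ x, |g x| ≤ K)
    (P : S → Measure (CadlagPath S)) (y : S) [IsProbabilityMeasure (P y)] {T : ℝ} (hT : 0 ≤ T) :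
    Integrable (fun ω : CadlagPath S => ∫ s in (0 : ℝ)..T, g (ω.1 s.toNNReal)) (P y) ∧
    IntervalIntegrable (fun s : ℝ => transition P s.toNNReal g y) volume 0 T ∧
    ∫ ω : CadlagPath S, (∫ s in (0 : ℝ)..T, g (ω.1 s.toNNReal)) ∂(P y)
      = ∫ s in (0 : ℝ)..T, transition P s.toNNReal g y := by
  have h := integrable_comp_eval_prod hg hK (P y) T
  simp only [intervalIntegral.integral_of_le hT, intervalIntegrable_iff_integrableOn_Ioc_of_le hT]
  refine ⟨h.integral_prod_right, h.integral_prod_left, ?_⟩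
  exact (integral_integral_swap (f := fun (s : ℝ) (ω : CadlagPath S) => g (ω.1 s.toNNReal)) h).symm

lemma integrable_comp_coord (hg : Continuous g) (hK : ∀ x, |g x| ≤ K)
    (P : Measure (CadlagPath S)) [IsProbabilityMeasure P] (t : ℝ≥0) :
    Integrable (fun ω : CadlagPath S => g (coord t ω)) P :=
  (integrable_const K).mono' (hg.measurable.comp (measurable_coord t)).aestronglyMeasurable
    (ae_of_all _ fun _ => hK _)

/-- The basic estimate on occupation times provided by a bounded function `v` with
`𝓛v ≤ g - h`. -/
lemma IsMPSolution.integral_transition_le {D : Set (S → ℝ)} {L : (S → ℝ) → S → ℝ}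
    (hint : IntegrableAlongPaths D L)
    {Sig : Set (CadlagPath S)} {P : S → Measure (CadlagPath S)} {y : S}
    (hP : IsMPSolution D L Sig (Measure.dirac y) (P y))
    {v h : S → ℝ} (hvD : v ∈ D) (hv : Continuous v) {U H : ℝ}
    (hvU : ∀ x, v x ∈ Icc (-U) 0) (hg : Continuous g) (hK : ∀ x, |g x| ≤ K)
    (hh : Continuous h) (hH : ∀ x, |h x| ≤ H) (hL : ∀ x, L v x ≤ g x - h x) (T : ℝ≥0) :
    ∫ s in (0 : ℝ)..T, transition P s.toNNReal h y
      ≤ U + ∫ s in (0 : ℝ)..T, transition P s.toNNReal g y := by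
  have := hP.isProbabilityMeasure
  have U0 : 0 ≤ U := by have := hvU y; simp only [mem_Icc] at this; linarith
  have K0 : 0 ≤ K := (abs_nonneg _).trans (hK y)
  have H0 : 0 ≤ H := (abs_nonneg _).trans (hH y)
  -- `L v` is only known to be integrable along each path. Replacing it by the bounded continuous `g
  -- - h` produces a minorant whose mean Fubini computes.
  have hlow : ∀ (t : ℝ≥0) (ω : CadlagPath S),
      v (ω.1 t) - v (ω.1 0) - ((∫ s in (0 : ℝ)..t, g (ω.1 s.toNNReal))
        - ∫ s in (0 : ℝ)..t, h (ω.1 s.toNNReal)) ≤ mpProcess v (L v) t ω := by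
    intro t ω
    rw [mpProcess, ← intervalIntegral.integral_sub (intervalIntegrable_comp_path hg hK ω _ _)
      (intervalIntegrable_comp_path hh hH ω _ _)]
    have := intervalIntegral.integral_mono_on t.coe_nonneg (hint v hvD ω t)
      ((intervalIntegrable_comp_path hg hK ω _ _).sub (intervalIntegrable_comp_path hh hH ω _ _))
      (fun s _ => hL (ω.1 s.toNNReal))
    exact sub_le_sub_left this _
  have hbd : ∀ (w : S → ℝ) (B : ℝ), (∀ x, |w x| ≤ B) → ∀ (t : ℝ≥0) (ω : CadlagPath S),
      |∫ s in (0 : ℝ)..t, w (ω.1 s.toNNReal)| ≤ B * t := by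
    intro w B hB t ω
    simpa using intervalIntegral.norm_integral_le_of_norm_le_const
      (a := (0 : ℝ)) (b := t) (f := fun s : ℝ => w (ω.1 s.toNNReal)) (C := B) fun s _ => hB _
  obtain ⟨ig, -, eg⟩ := integral_occupation hg hK P y T.coe_nonneg
  obtain ⟨ih, -, eh⟩ := integral_occupation hh hH P y T.coe_nonneg
  have hvabs : ∀ x, |v x| ≤ U := fun x => abs_le.2 ⟨(hvU x).1, (hvU x).2.trans U0⟩
  have iT := integrable_comp_coord hv hvabs (P y) T
  have i0 := integrable_comp_coord hv hvabs (P y) 0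
  have hmain := (hP.localMartingale v hvD).integral_nonpos_of_le
    (T := T) (c := U + (K * T + H * T)) (fun ω => by simp [mpProcess])
    (fun t ht ω => ?_) ((iT.sub i0).sub (ig.sub ih)) (hlow T)
  · simp only [Pi.sub_apply] at hmain
    have e3 := integral_sub' (iT.sub i0) (ig.sub ih)
    rw [integral_sub' ig ih, integral_sub' iT i0] at e3
    simp only [Pi.sub_apply] at e3
    rw [e3] at hmain
    have hv0 : ∫ ω, v (coord 0 ω) ∂(P y) = v y := by
      have := integral_map (μ := P y) (φ := coord 0) (measurable_coord (S := S) 0).aemeasurable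
        (f := v) hv.measurable.aestronglyMeasurable
      rw [← this, hP.initial,
        integral_dirac' v y hv.measurable.stronglyMeasurable]
    have hvT : -U ≤ ∫ ω, v (coord T ω) ∂(P y) := by
      have := integral_mono (μ := P y) (integrable_const (-U)) iT (fun ω => (hvU _).1)
      simpa using this
    have := (hvU y).2
    have e1 : ∫ ω : CadlagPath S, (∫ s in (0 : ℝ)..T, g (ω.1 s.toNNReal)) ∂(P y)
      = ∫ s in (0 : ℝ)..T, transition P s.toNNReal g y := eg
    have e2 : ∫ ω : CadlagPath S, (∫ s in (0 : ℝ)..T, h (ω.1 s.toNNReal)) ∂(P y)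
      = ∫ s in (0 : ℝ)..T, transition P s.toNNReal h y := eh
    rw [hv0] at hmain
    linarith
  · refine le_trans ?_ (hlow t ω)
    have h1 := abs_le.1 (hbd g K hK t ω)
    have h2 := abs_le.1 (hbd h H hH t ω)
    have h3 := hvU (ω.1 t)
    have h4 := hvU (ω.1 0)
    simp only [mem_Icc] at h3 h4
    have ht' : (t : ℝ) ≤ T := by exact_mod_cast ht
    have h5 := mul_le_mul_of_nonneg_left ht' K0
    have h6 := mul_le_mul_of_nonneg_left ht' H0
    linarith

/-- A Lyapunov criterion: if there are uniformly bounded test functions `v n` whose images under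
`𝓛` are at most `g - h n` with `g ∈ C_0(S)` and `h n → 1`, then solutions of the martingale
problem come back from infinity quickly, so that they cannot be Feller-Dynkin. -/
theorem not_isFellerDynkinFamily_of_lyapunov {D : Set (S → ℝ)} {L : (S → ℝ) → S → ℝ}
    (hint : IntegrableAlongPaths D L) {Sig : Set (CadlagPath S)} {P : S → Measure (CadlagPath S)}
    (hP : ∀ y, IsMPSolution D L Sig (Measure.dirac y) (P y))
    (g : ZeroAtInftyContinuousMap S ℝ) {U H : ℝ}
    {v h : ℕ → S → ℝ} (hvD : ∀ n, v n ∈ D) (hv : ∀ n, Continuous (v n))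
    (hvU : ∀ n x, v n x ∈ Icc (-U) 0) (hh : ∀ n, Continuous (h n)) (hH : ∀ n x, |h n x| ≤ H)
    (hlim : ∀ x, Tendsto (fun n => h n x) atTop (𝓝 1))
    (hL : ∀ n x, L (v n) x ≤ g x - h n x)
    {y : ℕ → S} (hy : Tendsto y atTop (cocompact S)) : ¬ IsFellerDynkinFamily P := by
  intro hFD
  have hprob : ∀ y, IsProbabilityMeasure (P y) := fun y => (hP y).isProbabilityMeasure
  obtain ⟨K, hK⟩ : ∃ K, ∀ x, |g x| ≤ K :=
    ⟨‖g.toBCF‖, fun x => g.toBCF.norm_coe_le_norm x⟩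
  have U0 : 0 ≤ U := by have := hvU 0 (y 0); simp only [mem_Icc] at this; linarith
  -- Any horizon larger than `U` contradicts the limit of `step` along `y k → ∞`.
  set T : ℝ≥0 := (U + 1).toNNReal
  have hT : (T : ℝ) = U + 1 := Real.coe_toNNReal _ (by linarith)
  have step : ∀ z, (T : ℝ) ≤ U + ∫ s in (0 : ℝ)..T, transition P s.toNNReal g z := by
    intro z
    have h1 : Tendsto (fun n => ∫ s in (0 : ℝ)..T, transition P s.toNNReal (h n) z) atTop
        (𝓝 (∫ s in (0 : ℝ)..T, (1 : ℝ))) := by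
      refine intervalIntegral.tendsto_integral_filter_of_dominated_convergence (fun _ => H) ?_ ?_
        intervalIntegrable_const ?_
      · exact Eventually.of_forall fun n => by
          have := (integral_occupation (hh n) (hH n) P z T.coe_nonneg).2.1.aestronglyMeasurable
          rwa [uIoc_of_le T.coe_nonneg]
      · exact Eventually.of_forall fun n => ae_of_all _ fun s _ => abs_transition_le (hH n) P z _
      · refine ae_of_all _ fun s _ => ?_
        have : (1 : ℝ) = ∫ _ω, (1 : ℝ) ∂(P z) := by simp
        rw [this]
        exact tendsto_integral_of_dominated_convergence (fun _ => H)
          (fun n => (integrable_comp_coord (hh n) (hH n) (P z) _).aestronglyMeasurable)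
          (integrable_const H) (fun n => ae_of_all _ fun ω => hH n _)
          (ae_of_all _ fun ω => hlim _)
    have h2 : ∫ s in (0 : ℝ)..T, (1 : ℝ) = T := by simp
    rw [h2] at h1
    exact le_of_tendsto' h1 fun n => (hP z).integral_transition_le hint (hvD n) (hv n) (hvU n)
      g.continuous hK (hh n) (hH n) (hL n) T
  have h3 : Tendsto (fun k => ∫ s in (0 : ℝ)..T, transition P s.toNNReal g (y k)) atTop
      (𝓝 (∫ s in (0 : ℝ)..T, (0 : ℝ))) := by
    refine intervalIntegral.tendsto_integral_filter_of_dominated_convergence (fun _ => K) ?_ ?_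
      intervalIntegrable_const ?_
    · exact Eventually.of_forall fun n => by
        have := (integral_occupation g.continuous hK P (y n) T.coe_nonneg).2.1.aestronglyMeasurable
        rwa [uIoc_of_le T.coe_nonneg]
    · exact Eventually.of_forall fun n => ae_of_all _ fun s _ => abs_transition_le hK P _ _
    · refine ae_of_all _ fun s _ => ?_
      obtain ⟨f, hf⟩ := hFD.map_C0 s.toNNReal g
      rw [← hf]
      exact f.zero_at_infty'.comp hy
  have h4 := ge_of_tendsto' (h3.const_add U) (fun k => step (y k))
  simp only [intervalIntegral.integral_zero] at h4
  linarith

end CadlagPaths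

/-! ### The generator on radial functions -/

section Radial

variable {d : ℕ} {ψ ψ₁ ψ₂ : ℝ → ℝ}

lemma hasFDerivAt_half_norm_sq {E : Type*} [NormedAddCommGroup E] [InnerProductSpace ℝ E] (x : E) :
    HasFDerivAt (fun x : E => ‖x‖ ^ 2 / 2) (innerSL ℝ x) x := by
  have := ((hasStrictFDerivAt_norm_sq x).hasFDerivAt).mul_const (1 / 2 : ℝ)
  simp only [mul_one_div] at this
  exact this.congr_fderiv (by ext v; simp)

lemma hasFDerivAt_radial {E : Type*} [NormedAddCommGroup E] [InnerProductSpace ℝ E]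
    (h₁ : ∀ y, HasDerivAt ψ (ψ₁ y) y) (x : E) :
    HasFDerivAt (fun x : E => ψ (‖x‖ ^ 2 / 2)) (ψ₁ (‖x‖ ^ 2 / 2) • innerSL ℝ x) x :=
  (h₁ _).comp_hasFDerivAt x (hasFDerivAt_half_norm_sq x)

lemma gradient_radial (h₁ : ∀ y, HasDerivAt ψ (ψ₁ y) y) (x : EuclideanSpace ℝ (Fin d)) :
    gradient (fun x : EuclideanSpace ℝ (Fin d) => ψ (‖x‖ ^ 2 / 2)) x = ψ₁ (‖x‖ ^ 2 / 2) • x := by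
  refine HasGradientAt.gradient ?_
  rw [hasGradientAt_iff_hasFDerivAt]
  exact (hasFDerivAt_radial h₁ x).congr_fderiv (by ext v; simp)

lemma hessianMatrix_radial (h₁ : ∀ y, HasDerivAt ψ (ψ₁ y) y) (h₂ : ∀ y, HasDerivAt ψ₁ (ψ₂ y) y)
    (x : EuclideanSpace ℝ (Fin d)) :
    hessianMatrix (fun x : EuclideanSpace ℝ (Fin d) => ψ (‖x‖ ^ 2 / 2)) x
      = ψ₂ (‖x‖ ^ 2 / 2) • Matrix.vecMulVec x.ofLp x.ofLp
        + ψ₁ (‖x‖ ^ 2 / 2) • (1 : Matrix (Fin d) (Fin d) ℝ) := by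
  have hf : fderiv ℝ (fun x : EuclideanSpace ℝ (Fin d) => ψ (‖x‖ ^ 2 / 2))
      = fun x => ψ₁ (‖x‖ ^ 2 / 2) • innerSL ℝ x :=
    funext fun x => (hasFDerivAt_radial h₁ x).fderiv
  have hd2 := (hasFDerivAt_radial h₂ x).smul
    ((innerSL ℝ : EuclideanSpace ℝ (Fin d) →L⋆[ℝ] _).hasFDerivAt (x := x))
  ext k l
  rw [hessianMatrix, Matrix.of_apply, iteratedFDeriv_two_apply, hf]
  erw [hd2.fderiv]
  simp only [Fin.isValue, Matrix.cons_val_zero, Matrix.cons_val_one, _root_.add_apply,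
    _root_.smul_apply, ContinuousLinearMap.smulRight_apply, smul_eq_mul,
    Matrix.add_apply, Matrix.smul_apply, Matrix.vecMulVec_apply, Matrix.one_apply]
  change ψ₁ _ * inner ℝ (EuclideanSpace.single k (1 : ℝ)) (EuclideanSpace.single l (1 : ℝ))
    + ψ₂ _ * inner ℝ x (EuclideanSpace.single k (1 : ℝ))
      * inner ℝ x (EuclideanSpace.single l (1 : ℝ)) = _
  simp only [EuclideanSpace.inner_single_right, PiLp.ofLp_single, Pi.single_apply,
    conj_trivial, one_mul, @eq_comm _ l k]
  ring

/-- A radial function sees the coefficients only through the two scalars that the growth conditions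
control; this reduces the problem to one dimension. -/
lemma diffusionOperator_radial {Sd : Type*}
    (b : EuclideanSpace ℝ (Fin d) × Sd → EuclideanSpace ℝ (Fin d))
    (a : EuclideanSpace ℝ (Fin d) × Sd → Matrix (Fin d) (Fin d) ℝ)
    (h₁ : ∀ y, HasDerivAt ψ (ψ₁ y) y) (h₂ : ∀ y, HasDerivAt ψ₁ (ψ₂ y) y)
    (y : EuclideanSpace ℝ (Fin d) × Sd) :
    diffusionOperator b a (fun y => ψ (‖y.1‖ ^ 2 / 2)) y
      = 1 / 2 * (ψ₂ (‖y.1‖ ^ 2 / 2) * (y.1.ofLp ⬝ᵥ (a y *ᵥ y.1.ofLp))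
        + ψ₁ (‖y.1‖ ^ 2 / 2) * ((a y).trace + 2 * inner ℝ y.1 (b y))) := by
  have htr : (Matrix.vecMulVec y.1.ofLp y.1.ofLp * a y).trace = y.1.ofLp ⬝ᵥ (a y *ᵥ y.1.ofLp) := by
    rw [Matrix.vecMulVec_mul, Matrix.trace_vecMulVec, Matrix.dotProduct_mulVec, dotProduct_comm]
  rw [diffusionOperator, gradient_radial h₁, hessianMatrix_radial h₁ h₂, add_mul, Matrix.trace_add,
    Matrix.smul_mul, Matrix.smul_mul, Matrix.trace_smul, Matrix.trace_smul, htr, Matrix.one_mul,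
    inner_smul_left]
  simp only [conj_trivial, smul_eq_mul]
  ring

/-- The row sums of `Q` vanish, so switching does not act on functions independent of the regime. -/
lemma switchingOperator_radial {Sd : Type*} [Fintype Sd]
    (b : EuclideanSpace ℝ (Fin d) × Sd → EuclideanSpace ℝ (Fin d))
    (a : EuclideanSpace ℝ (Fin d) × Sd → Matrix (Fin d) (Fin d) ℝ)
    {Q : EuclideanSpace ℝ (Fin d) → Matrix Sd Sd ℝ} (hQ : ∀ x, IsConservativeQMatrix (Q x))
    (h₁ : ∀ y, HasDerivAt ψ (ψ₁ y) y) (h₂ : ∀ y, HasDerivAt ψ₁ (ψ₂ y) y)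
    (y : EuclideanSpace ℝ (Fin d) × Sd) :
    switchingOperator b a Q (fun y => ψ (‖y.1‖ ^ 2 / 2)) y
      = 1 / 2 * (ψ₂ (‖y.1‖ ^ 2 / 2) * (y.1.ofLp ⬝ᵥ (a y *ᵥ y.1.ofLp))
        + ψ₁ (‖y.1‖ ^ 2 / 2) * ((a y).trace + 2 * inner ℝ y.1 (b y))) := by
  rw [switchingOperator, diffusionOperator_radial b a h₁ h₂]
  have h : ∑ j, Q y.1 y.2 j * ψ (‖y.1‖ ^ 2 / 2) = 0 := by
    rw [← Finset.sum_mul, (hQ y.1).row_sum, zero_mul]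
  exact (congrArg _ h).trans (add_zero _)

lemma isCb2_of_hasCompactSupport {f : EuclideanSpace ℝ (Fin d) → ℝ} (hf : ContDiff ℝ 2 f)
    (hs : HasCompactSupport f) : IsCb2 f := by
  have h : ∀ k ≤ 2, ∃ C, ∀ x, ‖iteratedFDeriv ℝ k f x‖ ≤ C := fun k hk =>
    (hf.continuous_iteratedFDeriv (by exact_mod_cast hk)).bounded_above_of_compact_support
      (hs.iteratedFDeriv k)
  choose! C hC using h
  refine ⟨hf, max (C 0) (max (C 1) (C 2)), fun k hk x => (hC k hk x).trans ?_⟩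
  interval_cases k <;> simp

lemma hasCompactSupport_radial {φ : ℝ → ℝ} {N : ℝ} (hφ : ∀ y, N ≤ y → φ y = 0) :
    HasCompactSupport fun x : EuclideanSpace ℝ (Fin d) => φ (‖x‖ ^ 2 / 2) := by
  refine HasCompactSupport.intro (isCompact_closedBall (0 : EuclideanSpace ℝ (Fin d)) (2 + |N|))
    fun x hx => hφ _ ?_
  rw [mem_closedBall_zero_iff, not_le] at hx
  have := le_abs_self N
  have := abs_nonneg N
  nlinarith

/-- Makes the Lyapunov functions admissible in `D`. Since `‖x‖ ^ 2 / 2` is proper, vanishing of `ψ`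
near `+∞` suffices for compact support; its values near `-∞` do not matter. -/
lemma isCb2_radial (h₁ : ∀ y, HasDerivAt ψ (ψ₁ y) y) (h₂ : ∀ y, HasDerivAt ψ₁ (ψ₂ y) y)
    (hc : Continuous ψ₂) {N : ℝ} (hN : ∀ y, N ≤ y → ψ y = 0) :
    IsCb2 fun x : EuclideanSpace ℝ (Fin d) => ψ (‖x‖ ^ 2 / 2) := by
  have e₁ : deriv ψ = ψ₁ := funext fun y => (h₁ y).deriv
  have e₂ : deriv ψ₁ = ψ₂ := funext fun y => (h₂ y).deriv
  have c₁ : ContDiff ℝ 1 ψ₁ :=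
    contDiff_one_iff_deriv.2 ⟨fun y => (h₂ y).differentiableAt, e₂ ▸ hc⟩
  have c₂ : ContDiff ℝ (1 + 1) ψ :=
    contDiff_succ_iff_deriv.2 ⟨fun y => (h₁ y).differentiableAt, by simp, e₁ ▸ c₁⟩
  rw [one_add_one_eq_two] at c₂
  exact isCb2_of_hasCompactSupport (c₂.comp ((contDiff_norm_sq ℝ).div_const 2))
    (hasCompactSupport_radial hN)

end Radial

/-! ### Cutoffs of the source term -/

section Truncation

/-- The continuous cutoff function which is `1` on `(-∞, N - 1]` and `0` on `[N, ∞)`. -/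
noncomputable def cutoff (N y : ℝ) : ℝ := max 0 (min 1 (N - y))

lemma continuous_cutoff (N : ℝ) : Continuous (cutoff N) := by
  unfold cutoff; fun_prop

lemma cutoff_nonneg (N y : ℝ) : 0 ≤ cutoff N y := le_max_left _ _

lemma cutoff_le_one (N y : ℝ) : cutoff N y ≤ 1 := max_le zero_le_one (min_le_left _ _)

lemma cutoff_eq_zero {N y : ℝ} (h : N ≤ y) : cutoff N y = 0 :=
  max_eq_left ((min_le_right _ _).trans (by linarith))

lemma cutoff_eq_one {N y : ℝ} (h : y + 1 ≤ N) : cutoff N y = 1 := by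
  rw [cutoff, min_eq_left (by linarith), max_eq_right zero_le_one]

lemma abs_cutoff_le (N y : ℝ) : |cutoff N y| ≤ 1 := by
  rw [abs_of_nonneg (cutoff_nonneg N y)]; exact cutoff_le_one N y

lemma tendsto_cutoff (y : ℝ) : Tendsto (fun n : ℕ => cutoff n y) atTop (𝓝 1) := by
  refine tendsto_const_nhds.congr' ?_
  obtain ⟨n, hn⟩ := exists_nat_ge (y + 1)
  filter_upwards [eventually_ge_atTop n] with m hm
  exact (cutoff_eq_one (hn.trans (by exact_mod_cast hm))).symm

end Truncation

/-! ### Scale densities and the one-dimensional equation -/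

section Scale

lemma LocallyHolderOn.continuousOn {f : ℝ → ℝ} {s : Set ℝ} (hf : LocallyHolderOn f s) :
    ContinuousOn f s := by
  intro z hz
  obtain ⟨u, hu, C, α, hα, -, hH⟩ := hf z hz
  exact ((hH.continuousOn hα) z (mem_of_mem_nhdsWithin hz hu)).mono_of_mem_nhdsWithin hu

/-- Used to extend coefficients from `[r, ∞)` to the whole line by freezing them at `r`. -/
lemma ContinuousOn.comp_max {f : ℝ → ℝ} {r : ℝ} (hf : ContinuousOn f (Ici r)) :
    Continuous fun z => f (max r z) :=
  hf.comp_continuous (by fun_prop) fun z => mem_Ici.2 (le_max_left r z)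

lemma hasDerivAt_scaleDensity {β : ℝ → ℝ} (hβ : Continuous β) (c y : ℝ) :
    HasDerivAt (scaleDensity β c) (-β y * scaleDensity β c y) y := by
  have := (hβ.integral_hasStrictDerivAt c y).hasDerivAt.neg.exp
  rw [mul_comm] at this
  exact this

lemma continuous_scaleDensity {β : ℝ → ℝ} (hβ : Continuous β) (c : ℝ) :
    Continuous (scaleDensity β c) :=
  continuous_iff_continuousAt.2 fun y => (hasDerivAt_scaleDensity hβ c y).continuousAt

lemma scaleDensity_pos (β : ℝ → ℝ) (c y : ℝ) : 0 < scaleDensity β c y := Real.exp_pos _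

lemma scaleDensity_congr {β γ : ℝ → ℝ} {c y : ℝ} (hy : c ≤ y) (h : ∀ z, c ≤ z → β z = γ z) :
    scaleDensity β c y = scaleDensity γ c y := by
  rw [scaleDensity, scaleDensity, intervalIntegral.integral_congr fun z hz => h z ?_]
  rw [uIcc_of_le hy] at hz
  exact hz.1

/-- A function which is infinite near `c` cannot be multiplied with an antitone function of
finite weighted integral. -/
lemma lt_top_of_lintegral_mul_lt_top {w : ℝ → ℝ} (hw : ∀ y, 0 < w y) {J : ℝ → ℝ≥0∞}
    (hJ : Antitone J) {c : ℝ} (hfin : ∫⁻ y in Ioi c, ENNReal.ofReal (w y) * J y < ∞)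
    {R : ℝ} (hR : c < R) : J R < ∞ := by
  by_contra h
  rw [not_lt, top_le_iff] at h
  refine hfin.ne (top_le_iff.1 ?_)
  calc ∞ = ∫⁻ _ in Ioc c R, (∞ : ℝ≥0∞) := by
        rw [setLIntegral_const, ENNReal.top_mul]
        simpa using hR
    _ ≤ ∫⁻ y in Ioc c R, ENNReal.ofReal (w y) * J y := by
        refine setLIntegral_mono' measurableSet_Ioc fun y hy => ?_
        have : J y = ∞ := top_le_iff.1 (h ▸ hJ hy.2)
        rw [this, ENNReal.mul_top (by simpa using hw y)]
    _ ≤ ∫⁻ y in Ioi c, ENNReal.ofReal (w y) * J y :=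
        lintegral_mono_set Ioc_subset_Ioi_self

lemma intervalIntegral_eq_zero_of_forall_ge {f : ℝ → ℝ} {N y : ℝ} (h : N ≤ y)
    (hf : ∀ z, N ≤ z → f z = 0) : ∫ z in N..y, f z = 0 := by
  rw [intervalIntegral.integral_congr (g := fun _ => (0 : ℝ)), intervalIntegral.integral_zero]
  intro z hz
  rw [uIcc_of_le h] at hz
  exact hf z hz.1

/-- The one-dimensional Lyapunov functions attached to an entrance boundary at infinity: uniformly
bounded, eventually zero functions `ψ` with `ψ'' + β ψ' ≤ -2 / α` except near the boundary of
their domain. -/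
lemma exists_radial_lyapunov {α β : ℝ → ℝ} (hα : Continuous α) (hβ : Continuous β)
    (hpos : ∀ z, 0 < α z) {c R : ℝ} (hR : c < R)
    (hfin : ∫⁻ y in Ioi c, ENNReal.ofReal (scaleDensity β c y) *
        (∫⁻ z in Ioi y, ENNReal.ofReal (1 / (α z * scaleDensity β c z))) < ∞) :
    ∃ U B : ℝ, 0 ≤ B ∧ ∀ N : ℝ, ∃ ψ ψ₁ ψ₂ : ℝ → ℝ, (∀ y, HasDerivAt ψ (ψ₁ y) y) ∧
      (∀ y, HasDerivAt ψ₁ (ψ₂ y) y) ∧ Continuous ψ₂ ∧ (∀ y, N ≤ y → ψ y = 0) ∧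
      (∀ y, ψ y ∈ Icc (-U) 0) ∧ (∀ y, 0 ≤ ψ₁ y) ∧ (∀ y < R, ψ₁ y = 0 ∧ ψ₂ y = 0) ∧
      (∀ y ∈ Icc R (R + 1), ψ₂ y + β y * ψ₁ y ≤ B) ∧
      ∀ y, R + 1 < y → ψ₂ y + β y * ψ₁ y = -(2 * cutoff N y / α y) := by
  -- Here `p` is the scale density, i.e. the derivative of the scale function.
  set p := scaleDensity β c with hp
  have pc : Continuous p := continuous_scaleDensity hβ c
  have pd : ∀ y, HasDerivAt p (-β y * p y) y := hasDerivAt_scaleDensity hβ c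
  have pp : ∀ y, 0 < p y := scaleDensity_pos β c
  set J : ℝ → ℝ≥0∞ := fun y => ∫⁻ z in Ioi y, ENNReal.ofReal (1 / (α z * p z)) with hJ
  have Janti : Antitone J := fun y z h => lintegral_mono_set (Ioi_subset_Ioi h)
  have JR : J R < ∞ := lt_top_of_lintegral_mul_lt_top pp Janti hfin hR
  set W := ∫⁻ y in Ioi c, ENNReal.ofReal (p y) * J y with hW
  -- the smooth cutoff at the inner boundary
  set χ : ℝ → ℝ := fun y => Real.smoothTransition (y - R) with hχ
  have χd : ContDiff ℝ 1 χ := (Real.smoothTransition.contDiff (n := 1)).comp (by fun_prop)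
  have χ' : ∀ y, HasDerivAt χ (deriv χ y) y := fun y =>
    (χd.differentiable (by norm_num) y).hasDerivAt
  have χc' : Continuous (deriv χ) := χd.continuous_deriv le_rfl
  have χ0 : ∀ y, 0 ≤ χ y := fun y => Real.smoothTransition.nonneg _
  have χ1 : ∀ y, χ y ≤ 1 := fun y => Real.smoothTransition.le_one _
  have χzero : ∀ y, y ≤ R → χ y = 0 := fun y hy =>
    Real.smoothTransition.zero_of_nonpos (by linarith)
  have χone : ∀ y, R + 1 ≤ y → χ y = 1 := fun y hy =>
    Real.smoothTransition.one_of_one_le (by linarith)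
  have χ'zero : ∀ y < R, deriv χ y = 0 := fun y hy => by
    have : χ =ᶠ[𝓝 y] fun _ => 0 := by filter_upwards [Iio_mem_nhds hy] with z hz using χzero z hz.le
    rw [this.deriv_eq, deriv_const]
  have χ'one : ∀ y, R + 1 < y → deriv χ y = 0 := fun y hy => by
    have : χ =ᶠ[𝓝 y] fun _ => 1 := by filter_upwards [Ioi_mem_nhds hy] with z hz using χone z hz.le
    rw [this.deriv_eq, deriv_const]
  obtain ⟨B, hB⟩ := (isCompact_Icc (a := R) (b := R + 1)).exists_bound_of_continuousOn
    (χc'.mul pc).continuousOn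
  have B0 : 0 ≤ B := (norm_nonneg _).trans (hB R ⟨le_rfl, by linarith⟩)
  -- Both constants are chosen before `N`: the truncated tails `G` are dominated by the full tail `2
  -- * J`.
  refine ⟨(2 * W).toReal, B * (2 * J R).toReal, by positivity, fun N => ?_⟩
  set F : ℝ → ℝ := fun z => 2 * cutoff N z / (α z * p z) with hF
  have Fc : Continuous F := ((continuous_cutoff N).const_mul 2).div (hα.mul pc)
    fun z => (mul_pos (hpos z) (pp z)).ne'
  have F0 : ∀ z, 0 ≤ F z := fun z => div_nonneg (mul_nonneg zero_le_two (cutoff_nonneg N z))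
    (mul_pos (hpos z) (pp z)).le
  have FN : ∀ z, N ≤ z → F z = 0 := fun z hz => by simp [hF, cutoff_eq_zero hz]
  set G : ℝ → ℝ := fun y => ∫ z in y..N, F z with hG
  have Gd : ∀ y, HasDerivAt G (-F y) y := fun y =>
    intervalIntegral.integral_hasDerivAt_left (Fc.intervalIntegrable _ _)
      (Fc.stronglyMeasurableAtFilter _ _) Fc.continuousAt
  have Gc : Continuous G := continuous_iff_continuousAt.2 fun y => (Gd y).continuousAt
  have GN : ∀ y, N ≤ y → G y = 0 := fun y hy => by
    rw [hG]
    simp only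
    rw [intervalIntegral.integral_symm, intervalIntegral_eq_zero_of_forall_ge hy FN, neg_zero]
  have G0 : ∀ y, 0 ≤ G y := fun y => by
    rcases le_total N y with h | h
    · rw [GN y h]
    · exact intervalIntegral.integral_nonneg h fun z _ => F0 z
  have GJ : ∀ y, ENNReal.ofReal (G y) ≤ 2 * J y := fun y => by
    rcases le_total N y with h | h
    · simp [GN y h]
    · rw [hG]
      simp only
      rw [intervalIntegral.integral_of_le h, ofReal_integral_eq_lintegral_ofReal
        (Fc.integrableOn_Ioc) (ae_of_all _ F0), hJ, ← lintegral_const_mul' _ _ (by simp)]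
      refine (lintegral_mono_set Ioc_subset_Ioi_self).trans (lintegral_mono fun z => ?_)
      rw [show (2 : ℝ≥0∞) = ENNReal.ofReal 2 by simp, ← ENNReal.ofReal_mul zero_le_two]
      refine ENNReal.ofReal_le_ofReal ?_
      rw [hF, mul_one_div]
      have := cutoff_le_one N z
      have := mul_pos (hpos z) (pp z)
      exact div_le_div_of_nonneg_right (by linarith) this.le
  have GR : ∀ y, R ≤ y → G y ≤ (2 * J R).toReal := fun y hy => by
    rw [← ENNReal.ofReal_le_iff_le_toReal (ENNReal.mul_lt_top (by simp) JR).ne]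
    exact (GJ y).trans (mul_le_mul_right (Janti hy) 2)
  -- Variation of constants: `p * G` solves `q' + β q = -2 * cutoff N / α` with `q = 0` from `N` on,
  -- and `χ` switches it off below `R`, at the cost of the error `χ' p G` on `[R, R + 1]`.
  set q : ℝ → ℝ := fun y => χ y * p y * G y with hq
  have q0 : ∀ y, 0 ≤ q y := fun y => mul_nonneg (mul_nonneg (χ0 y) (pp y).le) (G0 y)
  have qc : Continuous q := (χd.continuous.mul pc).mul Gc
  have qN : ∀ y, N ≤ y → q y = 0 := fun y hy => by rw [hq]; simp [GN y hy]
  have hψ : ∀ y, (∫ z in N..y, q z) ∈ Icc (-(2 * W).toReal) 0 := fun y => by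
    rcases le_total N y with h | h
    · rw [intervalIntegral_eq_zero_of_forall_ge h qN]
      exact ⟨by simp, le_rfl⟩
    · rw [intervalIntegral.integral_symm]
      refine ⟨neg_le_neg ?_, neg_nonpos.2 (intervalIntegral.integral_nonneg h fun z _ => q0 z)⟩
      rw [← ENNReal.ofReal_le_iff_le_toReal (ENNReal.mul_lt_top (by simp) hfin).ne,
        intervalIntegral.integral_of_le h, ofReal_integral_eq_lintegral_ofReal
        (qc.integrableOn_Ioc) (ae_of_all _ q0), hW, ← lintegral_const_mul' _ _ (by simp),
        -- The interval from `y` to `N` may reach below `c`, but `χ` kills the integrand there.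
        ← lintegral_indicator measurableSet_Ioi]
      refine (setLIntegral_le_lintegral _ _).trans (lintegral_mono fun z => ?_)
      by_cases hz : z ∈ Ioi c
      · rw [indicator_of_mem hz, mul_left_comm]
        refine le_trans ?_ (mul_le_mul_right (GJ z) _)
        rw [← ENNReal.ofReal_mul (pp z).le]
        refine ENNReal.ofReal_le_ofReal ?_
        rw [hq]
        simp only
        rw [mul_assoc]
        exact mul_le_of_le_one_left (mul_nonneg (pp z).le (G0 z)) (χ1 z)
      · have : z ≤ R := by rw [mem_Ioi, not_lt] at hz; linarith
        simp [hq, χzero z this]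
  set q' : ℝ → ℝ := fun y => (deriv χ y * p y + χ y * (-β y * p y)) * G y + χ y * p y * (-F y)
    with hq'
  have key : ∀ y, q' y + β y * q y = deriv χ y * p y * G y - χ y * (2 * cutoff N y / α y) := by
    intro y
    have h1 := (hpos y).ne'
    have h2 := (pp y).ne'
    simp only [hq', hq, hF]
    field_simp
    ring
  refine ⟨fun y => ∫ z in N..y, q z, q, q', fun y => (qc.integral_hasStrictDerivAt N y).hasDerivAt,
    fun y => ((χ' y).mul (pd y)).mul (Gd y), by fun_prop, fun y hy => ?_, hψ, q0, fun y hy => ?_,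
    fun y hy => ?_, fun y hy => ?_⟩
  · exact intervalIntegral_eq_zero_of_forall_ge hy qN
  · simp [hq, hq', χzero y hy.le, χ'zero y hy]
  · rw [key]
    have h1 : 0 ≤ χ y * (2 * cutoff N y / α y) := mul_nonneg (χ0 y)
      (div_nonneg (mul_nonneg zero_le_two (cutoff_nonneg N y)) (hpos y).le)
    have h2 : deriv χ y * p y * G y ≤ B * (2 * J R).toReal :=
      mul_le_mul ((le_abs_self _).trans (hB y hy)) (GR y hy.1) (G0 y) B0
    linarith
  · rw [key, χ'one y hy, χone y hy.le]
    ring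

end Scale

/-! ### Local bounds and points at infinity in the state space -/

section SwitchingDiffusion

variable {d : ℕ} {Sd : Type*}

/-- A locally bounded diffusion matrix has a locally bounded quadratic form. -/
lemma exists_quadraticForm_le [Finite Sd] [TopologicalSpace Sd]
    {a : EuclideanSpace ℝ (Fin d) × Sd → Matrix (Fin d) (Fin d) ℝ}
    (ha : ∀ K, IsCompact K → ∃ C : ℝ, ∀ y ∈ K, ∀ k l, |a y k l| ≤ C) (ρ : ℝ) :
    ∃ A : ℝ, 0 ≤ A ∧ ∀ y : EuclideanSpace ℝ (Fin d) × Sd, ‖y.1‖ ≤ ρ →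
      y.1.ofLp ⬝ᵥ (a y *ᵥ y.1.ofLp) ≤ A := by
  obtain ⟨C, hC⟩ := ha _ ((isCompact_closedBall (0 : EuclideanSpace ℝ (Fin d)) ρ).prod
    (Set.finite_univ (α := Sd)).isCompact)
  refine ⟨∑ _k : Fin d, ∑ _l : Fin d, |ρ| * (|C| * |ρ|), by positivity, fun y hy => ?_⟩
  simp only [dotProduct, Matrix.mulVec]
  refine Finset.sum_le_sum fun k _ => ?_
  rw [Finset.mul_sum]
  refine Finset.sum_le_sum fun l _ => (le_abs_self _).trans ?_
  have hx : ∀ k, |y.1.ofLp k| ≤ |ρ| := fun k =>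
    (PiLp.norm_apply_le y.1 k).trans (hy.trans (le_abs_self ρ))
  have h := (hC y ⟨mem_closedBall_zero_iff.2 hy, mem_univ _⟩ k l).trans (le_abs_self C)
  rw [abs_mul, abs_mul]
  exact mul_le_mul (hx k) (mul_le_mul h (hx l) (abs_nonneg _) (abs_nonneg _)) (by positivity)
    (abs_nonneg _)

/-- A multiple of the radial cutoff function, as an element of `C_0`. -/
noncomputable def radialCutoff [Finite Sd] [TopologicalSpace Sd] (C N : ℝ) :
    ZeroAtInftyContinuousMap (EuclideanSpace ℝ (Fin d) × Sd) ℝ where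
  toFun y := C * cutoff N (‖y.1‖ ^ 2 / 2)
  continuous_toFun := continuous_const.mul ((continuous_cutoff N).comp (by fun_prop))
  zero_at_infty' := by
    have hc : HasCompactSupport fun x : EuclideanSpace ℝ (Fin d) => cutoff N (‖x‖ ^ 2 / 2) :=
      hasCompactSupport_radial fun y hy => cutoff_eq_zero hy
    refine tendsto_const_nhds.congr' ?_
    filter_upwards [(hc.isCompact.prod (Set.finite_univ (α := Sd)).isCompact).compl_mem_cocompact]
      with y hy
    have : y.1 ∉ tsupport fun x : EuclideanSpace ℝ (Fin d) => cutoff N (‖x‖ ^ 2 / 2) :=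
      fun h => hy ⟨h, mem_univ _⟩
    have := image_eq_zero_of_notMem_tsupport this
    rw [this, mul_zero]

/-- Running along a coordinate axis, which exists because `0 < d`. -/
lemma exists_tendsto_cocompact (hd : 0 < d) [Nonempty Sd] [TopologicalSpace Sd] :
    ∃ y : ℕ → EuclideanSpace ℝ (Fin d) × Sd, Tendsto y atTop (cocompact _) := by
  refine ⟨fun n => (EuclideanSpace.single ⟨0, hd⟩ (n : ℝ), Classical.arbitrary Sd),
    Tendsto.mono_right (tendsto_comap_iff.2 ?_) (comap_cocompact_le continuous_fst)⟩
  refine tendsto_cocompact_of_tendsto_dist_comp_atTop 0 ?_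
  simpa using tendsto_natCast_atTop_atTop (R := ℝ)

end SwitchingDiffusion

/-! ### Comparison of the switching diffusion with the radial equation -/

theorem proposition5 {d : ℕ} (hd : 0 < d)
    {Sd : Type*} [Fintype Sd] [Nonempty Sd] [TopologicalSpace Sd] [DiscreteTopology Sd]
    [MeasurableSpace Sd] [BorelSpace Sd]
    (b : EuclideanSpace ℝ (Fin d) × Sd → EuclideanSpace ℝ (Fin d))
    (a : EuclideanSpace ℝ (Fin d) × Sd → Matrix (Fin d) (Fin d) ℝ)
    (Q : EuclideanSpace ℝ (Fin d) → Matrix Sd Sd ℝ)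
    (hcoef : IsSwitchingCoefficients b a Q)
    (hint : IntegrableAlongPaths (switchingTestFunctions d Sd) (switchingOperator b a Q))
    (P : EuclideanSpace ℝ (Fin d) × Sd →
      Measure (CadlagPath (EuclideanSpace ℝ (Fin d) × Sd)))
    (hP : ∀ y, IsMPSolution (switchingTestFunctions d Sd) (switchingOperator b a Q)
      (switchingPaths d Sd) (Measure.dirac y) (P y))
    (r : ℝ) (hr : 0 < r) (bd ad : ℝ → ℝ)
    (hbd : LocallyHolderOn bd (Ici r)) (had : LocallyHolderOn ad (Ici r))
    (had_pos : ∀ z ∈ Ici r, 0 < ad z)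
    (hbound_a : ∀ (i : Sd) (x : EuclideanSpace ℝ (Fin d)),
      2 * r ≤ ‖x‖ → r ≤ ‖x‖ ^ 2 / 2 →
        ad (‖x‖ ^ 2 / 2) ≤ x.ofLp ⬝ᵥ (a (x, i) *ᵥ x.ofLp))
    (hbound_b : ∀ (i : Sd) (x : EuclideanSpace ℝ (Fin d)),
      2 * r ≤ ‖x‖ → r ≤ ‖x‖ ^ 2 / 2 →
        (a (x, i)).trace + 2 * inner ℝ x (b (x, i))
          ≤ bd (‖x‖ ^ 2 / 2) * (x.ofLp ⬝ᵥ (a (x, i) *ᵥ x.ofLp)))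
    (hscale : Tendsto (scaleFunction bd (r + 1)) atTop atTop)
    (hfin : ∫⁻ y in Ioi (r + 1), ENNReal.ofReal (scaleDensity bd (r + 1) y) *
        (∫⁻ z in Ioi y, ENNReal.ofReal (1 / (ad z * scaleDensity bd (r + 1) z))) < ∞) :
    ¬ IsFellerDynkinFamily P := by

  set c := r + 1 with hc
  -- The extended coefficients are continuous on the line and unchanged on `[r, ∞)`. The scale
  -- density based at `c > r` does not see the change on `[c, ∞)`.
  set α : ℝ → ℝ := fun z => ad (max r z) with hα
  set β : ℝ → ℝ := fun z => bd (max r z) with hβ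
  have αc : Continuous α := had.continuousOn.comp_max
  have βc : Continuous β := hbd.continuousOn.comp_max
  have αpos : ∀ z, 0 < α z := fun z => had_pos _ (mem_Ici.2 (le_max_left r z))
  have αeq : ∀ z, r ≤ z → α z = ad z := fun z hz => by rw [hα]; simp only [max_eq_right hz]
  have βeq : ∀ z, r ≤ z → β z = bd z := fun z hz => by rw [hβ]; simp only [max_eq_right hz]
  have peq : ∀ y, c ≤ y → scaleDensity β c y = scaleDensity bd c y := fun y hy =>
    scaleDensity_congr hy fun z hz => βeq z (by linarith)
  have hfin' : ∫⁻ y in Ioi c, ENNReal.ofReal (scaleDensity β c y) *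
      (∫⁻ z in Ioi y, ENNReal.ofReal (1 / (α z * scaleDensity β c z))) < ∞ := by
    refine lt_of_le_of_lt (le_of_eq ?_) hfin
    refine setLIntegral_congr_fun measurableSet_Ioi fun y hy => ?_
    have hy' : c < y := hy
    rw [peq y hy'.le, setLIntegral_congr_fun measurableSet_Ioi fun z hz => ?_]
    have hz' : y < z := hz
    rw [peq z (hy'.trans hz').le, αeq z (by linarith)]
  -- `‖x‖ ^ 2 / 2 ≥ R` then forces both `‖x‖ ≥ 2 * r` and `‖x‖ ^ 2 / 2 ≥ r`.
  set R := c + 2 * r ^ 2 with hR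
  have hcR : c < R := by have := pow_pos hr 2; linarith
  obtain ⟨U, B, B0, hlyap⟩ := exists_radial_lyapunov αc βc αpos hcR hfin'
  obtain ⟨A, A0, hA⟩ := exists_quadraticForm_le hcoef.locallyBounded_a (R + 3)
  have hregion : ∀ x : EuclideanSpace ℝ (Fin d), R ≤ ‖x‖ ^ 2 / 2 →
      2 * r ≤ ‖x‖ ∧ r ≤ ‖x‖ ^ 2 / 2 := fun x hx =>
    ⟨abs_le_of_sq_le_sq' (by nlinarith) (norm_nonneg x) |>.2, by nlinarith⟩
  choose ψ ψ₁ ψ₂ h₁ h₂ hcont hzero hbdd hnonneg hin hmid hout using fun n : ℕ => hlyap n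
  obtain ⟨y, hy⟩ := exists_tendsto_cocompact (Sd := Sd) hd
  -- `B * A / 2` dominates the error on the shell `R ≤ V ≤ R + 1`, and the extra `1` pays for `h n ≤
  -- 1`. The level `R + 2` makes the cutoff equal to `1` up to `R + 1`.
  refine not_isFellerDynkinFamily_of_lyapunov hint hP (radialCutoff (B * A / 2 + 1) (R + 2))
    (U := U) (H := 1) (v := fun n y => ψ n (‖y.1‖ ^ 2 / 2))
    (h := fun n y => cutoff n (‖y.1‖ ^ 2 / 2))
    (fun n => Or.inl ⟨_, isCb2_radial (h₁ n) (h₂ n) (hcont n) (hzero n), rfl⟩)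
    (fun n => ?_) (fun n y => hbdd n _) (fun n => ?_) (fun n y => abs_cutoff_le _ _)
    (fun y => tendsto_cutoff _) (fun n y => ?_) hy
  · have : Continuous (ψ n) := continuous_iff_continuousAt.2 fun y => (h₁ n y).continuousAt
    fun_prop
  · exact (continuous_cutoff n).comp (by fun_prop)
  · rw [switchingOperator_radial b a hcoef.conservative_Q (h₁ n) (h₂ n)]
    change _ ≤ (B * A / 2 + 1) * cutoff (R + 2) (‖y.1‖ ^ 2 / 2) - cutoff n (‖y.1‖ ^ 2 / 2)
    have hcn := cutoff_le_one n (‖y.1‖ ^ 2 / 2)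
    have hBA := mul_nonneg B0 A0
    rcases lt_or_ge (‖y.1‖ ^ 2 / 2) R with hV | hV
    · rw [(hin n _ hV).1, (hin n _ hV).2, cutoff_eq_one (N := R + 2) (by linarith)]
      linarith
    obtain ⟨hr₁, hr₂⟩ := hregion y.1 hV
    have ha := hbound_a y.2 y.1 hr₁ hr₂
    have hb := mul_le_mul_of_nonneg_left (hbound_b y.2 y.1 hr₁ hr₂) (hnonneg n (‖y.1‖ ^ 2 / 2))
    rw [← αeq _ hr₂] at ha
    rw [← βeq _ hr₂] at hb
    have hq := hA y
    have hpos := αpos (‖y.1‖ ^ 2 / 2)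
    set V := ‖y.1‖ ^ 2 / 2 with hVdef
    set e := y.1.ofLp ⬝ᵥ (a y *ᵥ y.1.ofLp) with he
    have e0 : 0 ≤ e := hpos.le.trans ha
    -- Monotonicity `ψ₁ ≥ 0` is what lets the one-sided drift bound be inserted.
    have hL : 1 / 2 * (ψ₂ n V * e + ψ₁ n V * ((a y).trace + 2 * inner ℝ y.1 (b y)))
        ≤ 1 / 2 * ((ψ₂ n V + β V * ψ₁ n V) * e) := by linarith
    refine hL.trans ?_
    rcases le_or_gt V (R + 1) with hV₁ | hV₁
    · rw [cutoff_eq_one (N := R + 2) (by linarith)]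
      -- `‖y.1‖ ^ 2 ≤ 2 * (R + 1) ≤ (R + 3) ^ 2`, so the local bound `A` applies.
      have hy₁ : ‖y.1‖ ≤ R + 3 := by
        refine abs_le_of_sq_le_sq' ?_ (by nlinarith) |>.2
        nlinarith
      have h3 := mul_le_mul (hmid n V ⟨hV, hV₁⟩) (hq hy₁) e0 B0
      linarith
    · rw [hout n V hV₁]
      have h3 : cutoff n V ≤ cutoff n V / α V * e := by
        rw [div_mul_eq_mul_div, le_div_iff₀ hpos]
        exact mul_le_mul_of_nonneg_left ha (cutoff_nonneg _ _)
      have h4 : -(2 * cutoff n V / α V) * e = -2 * (cutoff n V / α V * e) := by ring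
      have h5 := mul_nonneg (by linarith : (0 : ℝ) ≤ B * A / 2 + 1) (cutoff_nonneg (R + 2) V)
      rw [h4]
      linarith
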